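/- **Instruction sequences.** Consider Boolean registers: input registers $\mathrm{in}{:}1,\mathrm{in}{:}2,\ldots$, auxiliary registers $\mathrm{aux}{:}1,\mathrm{aux}{:}2,\ldots$, and one output register $\mathrm{out}$. The basic instructions are $f.\mathrm{get}$ (reply: the content of $f$) for $f$ an input or auxiliary register, and $f.\mathrm{set}{:}b$ (the content of $f$ becomes $b$; reply: $b$) for $f$ an auxiliary register or $\mathrm{out}$ and $b\in\mathbb B=\{\mathsf T,\mathsf F\}$. Let $IS_{br}$ be the set of all non-empty finite sequences of primitive instructions, which are: a plain basic instruction $a$, a positive test $+a$, a negative test $-a$, a forward jump $\#l$ ($l\in\mathbb N$), and termination $!$. Execution starts at the first instruction. After $a$ it proceeds with the next instruction; after $+a$ (resp. $-a$) it proceeds with the next instruction if the reply is $\mathsf T$ (resp. $\mathsf F$) and skips one instruction otherwise; $\#l$ proceeds with the $l$th next instruction; $!$ terminates. If there is no instruction to proceed with, or at $\#0$, execution becomes inactive. $X\in IS_{br}$ *computes* $f:\mathbb B^n\to\mathbb B$ if for some $l$, for all $b_1,\ldots,b_n\in\mathbb B$, execution of $X$ with only the registers $\mathrm{in}{:}1,\ldots,\mathrm{in}{:}n$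 (initial contents $b_1,\ldots,b_n$), $\mathrm{aux}{:}1,\ldots,\mathrm{aux}{:}l$ and $\mathrm{out}$ (initial contents $\mathsf F$) available terminates (without accessing any other register) with content $f(b_1,\ldots,b_n)$ in $\mathrm{out}$. **Classes and completeness.** A Boolean function family is a sequence $(f_n)_{n\in\mathbb N}$ with $f_n:\mathbb B^n\to\mathbb B$. Let $\mathrm{poly}$ be the set of all $h:\mathbb N\to\mathbb N$ with $h(n)=O(n^k)$ for some $k\in\mathbb N$. - $\mathrm{PLIS}$ is the class of all families $(f_n)$ for which there is an $h\in\mathrm{poly}$ such that each $f_n$ is computed by some $X\in IS_{br}$ of length at most $h(n)$. - $\mathrm{NPLIS}$ is the class of all families $(f_n)$ for which there are a monotonic (non-decreasing) $h\in\mathrm{poly}$ and a family $(g_n)\in\mathrm{PLIS}$ such that, for all $n$ and all $w\in\mathbb B^n$, $f_n(w)=\mathsf T$ iff $g_{n+h(n)}(w\,c)=\mathsf T$ for some $c\in\mathbb B^{h(n)}$. - $(f_n)$ is *non-uniform polynomial-length $IS_{br}$-reducible* to $(g_n)$ if there is an $h\in\mathrm{poly}$ such that for all $n$ there are $l,m\le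 h(n)$ and functions $h_1,\ldots,h_m:\mathbb B^n\to\mathbb B$, each computed by an element of $IS_{br}$ of length at most $l$, with $f_n(b)=g_m(h_1(b),\ldots,h_m(b))$ for all $b\in\mathbb B^n$. - A family is *$\mathrm{NPLIS}$-complete* if it lies in $\mathrm{NPLIS}$ and every family in $\mathrm{NPLIS}$ is non-uniform polynomial-length $IS_{br}$-reducible to it. **3SATC.** For $k\in\mathbb N$ let $d(k)=\binom{2k}{1}+\binom{2k}{2}+\binom{2k}{3}$, and let $$\alpha_k:\{1,\ldots,d(k)\}\to\{L\subseteq\{v_1,\lnot v_1,\ldots,v_k,\lnot v_k\} : 1\le |L|\le 3\}\qquad(k\in\mathbb N)$$ be any family of bijections such that $\alpha_{k+1}(j)=\alpha_k(j)$ for all $k$ and all $j\le d(k)$ (in particular, any such family that is computable in polynomial time). The family $\mathrm{3SATC}=(\mathrm{3SATC}_n)_{n\in\mathbb N}$ is defined as follows: for $n\in\mathbb N$, let $k$ be the unique number with $d(k)\le n<d(k+1)$; then $\mathrm{3SATC}_n(b_1,\ldots,b_n)=\mathsf T$ iff the formula $$\bigwedge_{1\le i\le d(k),\ b_i=\mathsf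 T}\ \bigvee\alpha_k(i)$$ is satisfiable. **Theorem.** $\mathrm{3SATC}$ is $\mathrm{NPLIS}$-complete. -/

import Mathlib

namespace InSeq

/-! ### Instructions and finite instruction sequences -/

/-- Names of Boolean registers. Registers are counted from `0`: `inp i` and `aux i` name the
`(i+1)`-th input register and the `(i+1)`-th auxiliary register. -/
inductive Focus where
  | inp (i : ℕ)
  | aux (i : ℕ)
  | out
  deriving DecidableEq

/-- The methods of Boolean registers: `set b` and `get`. -/
inductive Method where
  | set (b : Bool)
  | get

/-- A basic instruction `f.m`; basic instructions also serve as the basic actions of threads. -/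
structure Basic where
  focus : Focus
  method : Method

/-- Primitive instructions: plain basic instructions `a`, positive tests `+a`, negative tests
`-a`, forward jumps `#l` and the termination instruction `!`. -/
inductive Instr where
  | plain (a : Basic)
  | ptst (a : Basic)
  | ntst (a : Basic)
  | jump (l : ℕ)
  | halt

/-- The basic instructions that read an input register, read or write an auxiliary register, or
write the output register. -/
def Basic.Allowed : Basic → Prop
  | ⟨.inp _, .get⟩ => True
  | ⟨.inp _, .set _⟩ => False
  | ⟨.aux _, _⟩ => True
  | ⟨.out, .set _⟩ => True
  | ⟨.out, .get⟩ => False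

/-- The primitive instructions all of whose basic instructions are allowed. -/
def Instr.Allowed : Instr → Prop
  | .plain a => a.Allowed
  | .ptst a => a.Allowed
  | .ntst a => a.Allowed
  | .jump _ => True
  | .halt => True

/-- The set of all non-empty finite instruction sequences that act on Boolean registers. -/
def ISbr : Set (List Instr) := {X | X ≠ [] ∧ ∀ u ∈ X, u.Allowed}

/-! ### Threads -/

/-- Finite threads: inaction `D`, termination `S`, `tau ∘ x`, and postconditional composition
`x ⊴ a ⊵ y`, written `post x a y`. Composition with the internal action needs only one operand,
by the axiom `x ⊴ tau ⊵ y = tau ∘ x`. -/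
inductive Thread where
  | dead
  | done
  | tau (x : Thread)
  | post (x : Thread) (a : Basic) (y : Thread)

/-- The behaviour of an instruction sequence on execution, if its first `k` instructions are
skipped; inaction if there is no instruction to proceed with. -/
def extractFrom : ℕ → List Instr → Thread
  | _, [] => .dead
  | k + 1, _ :: X => extractFrom k X
  | 0, .plain a :: X => .post (extractFrom 0 X) a (extractFrom 0 X)
  | 0, .ptst a :: X => .post (extractFrom 0 X) a (extractFrom 1 X)
  | 0, .ntst a :: X => .post (extractFrom 1 X) a (extractFrom 0 X)
  | 0, .jump 0 :: _ => .dead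
  | 0, .jump (l + 1) :: X => extractFrom l X
  | 0, .halt :: _ => .done

/-- Thread extraction `|X|`. -/
def extract (X : List Instr) : Thread := extractFrom 0 X

/-! The defining equations of thread extraction. For a one-element sequence `a`, `+a` or `-a`
they are read with `X = []`, where `extract [] = D`. -/

theorem extract_nil : extract [] = .dead := by simp [extract, extractFrom]

theorem extract_plain (a : Basic) (X : List Instr) :
    extract (.plain a :: X) = .post (extract X) a (extract X) := by
  simp [extract, extractFrom]

theorem extract_ptst (a : Basic) (X : List Instr) :
    extract (.ptst a :: X) = .post (extract X) a (extract (.jump 2 :: X)) := by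
  simp [extract, extractFrom]

theorem extract_ntst (a : Basic) (X : List Instr) :
    extract (.ntst a :: X) = .post (extract (.jump 2 :: X)) a (extract X) := by
  simp [extract, extractFrom]

theorem extract_jump_nil (l : ℕ) : extract [.jump l] = .dead := by
  cases l <;> simp [extract, extractFrom]

theorem extract_jump_zero (X : List Instr) : extract (.jump 0 :: X) = .dead := by
  simp [extract, extractFrom]

theorem extract_jump_one (X : List Instr) : extract (.jump 1 :: X) = extract X := by
  simp [extract, extractFrom]

theorem extract_jump_add_two (l : ℕ) (u : Instr) (X : List Instr) :
    extract (.jump (l + 2) :: u :: X) = extract (.jump (l + 1) :: X) := by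
  simp [extract, extractFrom]

theorem extract_halt (X : List Instr) : extract (.halt :: X) = .done := by
  simp [extract, extractFrom]

/-! ### Services -/

/-- Replies of services: a Boolean value or `blocked`. -/
inductive Reply where
  | val (b : Bool)
  | blocked

/-- The empty service and the Boolean register services `BR_b`. -/
inductive Service where
  | empty
  | br (b : Bool)

/-- The service that results from processing a method. -/
def Service.derive : Method → Service → Service
  | _, .empty => .empty
  | .set b, .br _ => .br b
  | .get, .br b => .br b

/-- The reply of a service to a method. -/
def Service.reply : Method → Service → Reply
  | _, .empty => .blocked
  | .set b, .br _ => .val b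
  | .get, .br b => .val b

/-- The use operator: the thread that results from `x` if the service `S` named `f` processes the
basic actions of the form `f.m` that `x` performs. -/
def use (f : Focus) : Thread → Service → Thread
  | .dead, _ => .dead
  | .done, _ => .done
  | .tau x, S => .tau (use f x S)
  | .post x a y, S =>
    if a.focus = f then
      match S.reply a.method with
      | .val true => .tau (use f x (S.derive a.method))
      | .val false => .tau (use f y (S.derive a.method))
      | .blocked => .tau .dead
    else .post (use f x S) a (use f y S)

/-- The apply operator: the service that results from `S`, named `f`, if it processes the basic
actions that the thread `x` performs. -/
def apply (f : Focus) : Thread → Service → Service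
  | .dead, _ => .empty
  | .done, S => S
  | .tau x, S => apply f x S
  | .post x a y, S =>
    if a.focus = f then
      match S.reply a.method with
      | .val true => apply f x (S.derive a.method)
      | .val false => apply f y (S.derive a.method)
      | .blocked => .empty
    else .empty

/-! ### Boolean functions and the non-uniform complexity classes -/

/-- The `n`-ary Boolean functions. -/
abbrev BoolFun (n : ℕ) : Type := (Fin n → Bool) → Bool

/-- Boolean function families. -/
abbrev BoolFamily : Type := (n : ℕ) → BoolFun n

/-- The thread `x` using auxiliary registers `0, …, l-1`, each with content `false`. -/
def useAux (l : ℕ) (x : Thread) : Thread :=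
  (List.range l).foldl (fun p i => use (.aux i) p (.br false)) x

/-- The thread `x` using input registers `0, …, n-1` with contents `b 0, …, b (n-1)`. -/
def useInp {n : ℕ} (b : Fin n → Bool) (x : Thread) : Thread :=
  (List.finRange n).foldl (fun p (i : Fin n) => use (.inp i) p (.br (b i))) x

/-- `X` computes `f`: for some number `l` of auxiliary registers, on every input `b` the output
register, with initial content `false`, ends up with content `f b`. -/
def Computes (X : List Instr) {n : ℕ} (f : BoolFun n) : Prop :=
  ∃ l : ℕ, ∀ b : Fin n → Bool,
    apply .out (useInp b (useAux l (extract X))) (.br false) = .br (f b)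

/-- The class `IS \ FN` of Boolean function families computed by instruction sequences from `IS`
whose lengths are bounded by a function from `FN`. -/
def NUC (IS : Set (List Instr)) (FN : Set (ℕ → ℕ)) : Set BoolFamily :=
  {f | ∃ h ∈ FN, ∀ n, ∃ X ∈ IS, Computes X (f n) ∧ X.length ≤ h n}

/-- The nondeterministic counterpart of `NUC IS FN`. The certificate `c` is appended to the
input `w`. -/
def NDNUC (IS : Set (List Instr)) (FN : Set (ℕ → ℕ)) : Set BoolFamily :=
  {f | ∃ h ∈ FN, Monotone h ∧ ∃ g ∈ NUC IS FN, ∀ (n : ℕ) (w : Fin n → Bool),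
    f n w = true ↔ ∃ c : Fin (h n) → Bool, g (n + h n) (Fin.append w c) = true}

/-- The polynomial functions, i.e. the functions `h` with `h n = O(n ^ k)` for some `k`. -/
def poly : Set (ℕ → ℕ) :=
  {h | ∃ k : ℕ, Asymptotics.IsBigO Filter.atTop (fun n => (h n : ℝ)) (fun n => (n : ℝ) ^ k)}

/-- `f` is `l`-length `IS`-reducible to `g`. -/
def LengthReducible (IS : Set (List Instr)) (l : ℕ) {n m : ℕ} (f : BoolFun n) (g : BoolFun m) :
    Prop :=
  ∃ H : Fin m → BoolFun n,
    (∀ i, ∃ X ∈ IS, Computes X (H i) ∧ X.length ≤ l) ∧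
    ∀ b : Fin n → Bool, f b = g (fun i => H i b)

/-- `f` is non-uniform `FN`-length `IS`-reducible to `g`. -/
def Reducible (IS : Set (List Instr)) (FN : Set (ℕ → ℕ)) (f g : BoolFamily) : Prop :=
  ∃ h ∈ FN, ∀ n, ∃ l m : ℕ, l ≤ h n ∧ m ≤ h n ∧ LengthReducible IS l (f n) (g m)

/-- `f` is complete for the class `NDNUC IS FN`. -/
def NDComplete (IS : Set (List Instr)) (FN : Set (ℕ → ℕ)) (f : BoolFamily) : Prop :=
  f ∈ NDNUC IS FN ∧ ∀ g ∈ NDNUC IS FN, Reducible IS FN g f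

/-! ### The Boolean function family 3SATC -/

/-- Literals over the propositional variables `v_0, v_1, …`: `(i, true)` is `v_i` and
`(i, false)` is its negation. -/
abbrev Literal : Type := ℕ × Bool

/-- The sets of one, two or three literals over the first `k` propositional variables. -/
abbrev Clause (k : ℕ) : Type :=
  {L : Finset Literal // (∀ x ∈ L, x.1 < k) ∧ 1 ≤ L.card ∧ L.card ≤ 3}

/-- The number of disjunctions of at most three literals over `k` variables. -/
def ndisj (k : ℕ) : ℕ := (2 * k).choose 1 + (2 * k).choose 2 + (2 * k).choose 3

theorem ndisj_mono : Monotone ndisj := by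
  intro a b hab
  have h : 2 * a ≤ 2 * b := by omega
  exact add_le_add (add_le_add (Nat.choose_le_choose _ h) (Nat.choose_le_choose _ h))
    (Nat.choose_le_choose _ h)

theorem self_le_ndisj (k : ℕ) : k ≤ ndisj k := by
  simp only [ndisj, Nat.choose_one_right]; omega

theorem ndisj_zero : ndisj 0 = 0 := rfl

/-- The greatest `k` with `ndisj k ≤ n`. -/
def level (n : ℕ) : ℕ := Nat.findGreatest (fun k => ndisj k ≤ n) n

theorem ndisj_level_le (n : ℕ) : ndisj (level n) ≤ n :=
  Nat.findGreatest_spec (P := fun k => ndisj k ≤ n) (Nat.zero_le n) (Nat.zero_le n)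

theorem level_eq {n k : ℕ} (h₁ : ndisj k ≤ n) (h₂ : n < ndisj (k + 1)) : level n = k := by
  refine le_antisymm ?_ (Nat.le_findGreatest ((self_le_ndisj k).trans h₁) h₁)
  by_contra! hlt
  have := ndisj_mono (Nat.succ_le_of_lt hlt)
  have := ndisj_level_le n
  simp only [Nat.succ_eq_add_one] at *
  omega

/-- The conjunction of the disjunctions `α_k(i)` with `b i = true` is satisfiable. -/
def Satisfiable (α : ∀ k, Fin (ndisj k) ≃ Clause k) (k : ℕ) (b : Fin (ndisj k) → Bool) : Prop :=
  ∃ σ : ℕ → Bool, ∀ i, b i = true → ∃ x ∈ (α k i).1, σ x.1 = x.2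

open Classical in
/-- The Boolean function family 3SATC based on the enumerations `α_k` of clauses: with `k`
greatest such that `ndisj k ≤ n`, the first `ndisj k` of the `n` arguments indicate which clauses
occur, and the remaining arguments are ignored. -/
noncomputable def threeSATC (α : ∀ k, Fin (ndisj k) ≃ Clause k) : BoolFamily :=
  fun n b => decide (Satisfiable α (level n) (fun i => b (Fin.castLE (ndisj_level_le n) i)))

end InSeq

namespace InSeq

/-! ### Boolean semantics of threads -/

/-! Membership: the certificate is a truth assignment. The formula "clause `i` is absent or one of
its at most three literals holds" is a CNF over the input bits and certificate bits, with one
disjunction of at most four literals per clause. Such a CNF is evaluated by short test-and-jump code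
(`cnfCode`).

Hardness: let `X` compute the verifier. All jumps go forward, so a run of `X` takes at most
`X.length` steps, and only polynomially many facts matter: which thread remains after `t` steps, and
what each relevant register contains then. These observations are the propositional variables. No
clauses describing the steps are written out. Since the reduction is non-uniform, it can switch on
every clause of at most three literals that holds in all accepting runs, together with unit clauses
fixing the input bits.

A satisfying assignment then agrees, on any three observations, with some accepting run
(`locallyConsistent_of_clauses`). One step of execution is governed by implications from two
observations at time `t` to one at time `t + 1`, so these implications transfer to the assignment.
The assignment therefore follows the actual run on the given input, with a certificate read off from
its values at time 0, and that run must output true (`run_eq_true_of_locallyConsistent`).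
Conversely, an accepting run satisfies all the clauses. Each bit of the reduction is a constant or a
single input literal, so code of length 5 suffices (`lengthReducible_threeSATC`). -/

/-- The reply to a basic instruction in a state in which all registers are available. -/
def Basic.value (a : Basic) (s : Focus → Bool) : Bool :=
  match a.method with
  | .set b => b
  | .get => s a.focus

/-- The state after a basic instruction. -/
def Basic.effect (a : Basic) (s : Focus → Bool) : Focus → Bool :=
  Function.update s a.focus (a.value s)

/-- The final content of the output register if all registers are available; `none` if execution
becomes inactive. -/
def run : Thread → (Focus → Bool) → Option Bool
  | .dead, _ => none
  | .done, s => some (s .out)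
  | .tau x, s => run x s
  | .post x a y, s => if a.value s then run x (a.effect s) else run y (a.effect s)

/-- The final service named `out` if `x` is executed with the services `ρ`. -/
def exec : Thread → (Focus → Service) → Service
  | .dead, _ => .empty
  | .done, ρ => ρ .out
  | .tau x, ρ => exec x ρ
  | .post x a y, ρ =>
    match (ρ a.focus).reply a.method with
    | .val true => exec x (Function.update ρ a.focus ((ρ a.focus).derive a.method))
    | .val false => exec y (Function.update ρ a.focus ((ρ a.focus).derive a.method))
    | .blocked => .empty

theorem apply_eq_exec (x : Thread) (S : Service) :
    apply .out x S = exec x (Function.update (fun _ => .empty) .out S) := by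
  induction x generalizing S with
  | dead => rfl
  | done => simp [apply, exec]
  | tau x ih => simpa [apply, exec] using ih S
  | post x a y ihx ihy =>
    by_cases h : a.focus = .out
    · simp only [apply, exec, h, if_true, Function.update_self, Function.update_idem, ihx, ihy]
    · simp [apply, exec, h, Service.reply]

/-- `use` turns the actions on `f` into internal steps, so supplying the service beforehand or
through the environment makes no difference. The register `out` is excluded because its service is
the result read at termination. -/
theorem exec_use (f : Focus) (x : Thread) (S : Service) (ρ : Focus → Service)
    (hf : f ≠ .out) (hρ : ρ f = .empty) : exec (use f x S) ρ = exec x (Function.update ρ f S) := by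
  induction x generalizing S ρ with
  | dead => rfl
  | done =>
    simp [use, exec, Function.update_of_ne hf.symm]
  | tau x ih => simpa [use, exec] using ih S ρ hρ
  | post x a y ihx ihy =>
    by_cases h : a.focus = f
    · subst h
      simp only [use, exec, if_true, Function.update_self, Function.update_idem]
      split <;> simp_all [exec]
    · simp only [use, exec, h, if_false, Function.update_of_ne h]
      split
      · rw [ihx _ _ (by rw [Function.update_of_ne (Ne.symm h), hρ]), Function.update_comm h]
      · rw [ihy _ _ (by rw [Function.update_of_ne (Ne.symm h), hρ]), Function.update_comm h]
      · rfl

theorem exec_foldl_use {ι : Type*} (nm : ι → Focus) (S : ι → Service) (is : List ι)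
    (hnd : (is.map nm).Nodup) (hout : ∀ i, nm i ≠ .out) (x : Thread) (ρ : Focus → Service)
    (hρ : ∀ i, ρ (nm i) = .empty) :
    exec (is.foldl (fun p i => use (nm i) p (S i)) x) ρ =
      exec x (is.foldr (fun i ρ => Function.update ρ (nm i) (S i)) ρ) := by
  induction is generalizing x with
  | nil => rfl
  | cons i is ih =>
    simp only [List.map_cons, List.nodup_cons] at hnd
    rw [List.foldl_cons, ih hnd.2, List.foldr_cons, exec_use _ _ _ _ (hout i)]
    -- As the names are distinct, the services supplied by the rest of the list leave `nm i` empty.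
    have key : ∀ is : List ι, nm i ∉ is.map nm →
        is.foldr (fun i ρ => Function.update ρ (nm i) (S i)) ρ (nm i) = .empty := by
      intro is
      induction is with
      | nil => intro _; exact hρ i
      | cons j js ihj =>
        intro h
        simp only [List.map_cons, List.mem_cons, not_or] at h
        rw [List.foldr_cons, Function.update_of_ne h.1]
        exact ihj h.2
    exact key is hnd.1

theorem foldr_update_apply {ι : Type*} (nm : ι → Focus) (S : ι → Service)
    (hnm : Function.Injective nm) (is : List ι) (ρ : Focus → Service) (i : ι) (hi : i ∈ is) :
    is.foldr (fun i ρ => Function.update ρ (nm i) (S i)) ρ (nm i) = S i := by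
  induction is with
  | nil => simp at hi
  | cons j js ih =>
    by_cases h : i = j
    · subst h; simp
    · rw [List.foldr_cons, Function.update_of_ne (hnm.ne h)]
      exact ih (by simpa [h] using hi)

theorem foldr_update_of_notMem {ι : Type*} (nm : ι → Focus) (S : ι → Service)
    (is : List ι) (ρ : Focus → Service) (f : Focus) (hf : ∀ i ∈ is, nm i ≠ f) :
    is.foldr (fun i ρ => Function.update ρ (nm i) (S i)) ρ f = ρ f := by
  induction is with
  | nil => rfl
  | cons j js ih =>
    rw [List.foldr_cons, Function.update_of_ne (hf j (by simp)).symm]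
    exact ih fun i hi => hf i (by simp [hi])

/-- The registers available with `n` input registers and `l` auxiliary registers. -/
def avail (n l : ℕ) : Focus → Prop
  | .inp i => i < n
  | .aux i => i < l
  | .out => True

/-- The initial state for input `b`. -/
def initState {n : ℕ} (b : Fin n → Bool) : Focus → Bool
  | .inp i => if h : i < n then b ⟨i, h⟩ else false
  | .aux _ => false
  | .out => false

open Classical in
/-- The services of the registers in `A`, with contents `s`. -/
noncomputable def services (A : Focus → Prop) (s : Focus → Bool) (f : Focus) : Service :=
  if A f then .br (s f) else .empty

theorem apply_useInp_useAux {n : ℕ} (b : Fin n → Bool) (l : ℕ) (x : Thread) :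
    apply .out (useInp b (useAux l x)) (.br false) =
      exec x (services (avail n l) (initState b)) := by
  have hinp : Function.Injective (fun i : Fin n => Focus.inp i) := by
    intro i j h; simpa [Fin.ext_iff] using h
  have haux : Function.Injective Focus.aux := by
    intro i j h; simpa using h
  rw [apply_eq_exec, useInp,
    exec_foldl_use (fun i : Fin n => Focus.inp i) (fun i => .br (b i)) _
      ((List.nodup_finRange n).map hinp) (by simp) _ _ (by simp), useAux,
    exec_foldl_use Focus.aux (fun _ => .br false) _
      ((List.nodup_range).map haux) (by simp) _ _ (by
        intro i
        rw [foldr_update_of_notMem _ _ _ _ _ (by simp)]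
        simp)]
  congr 1
  funext f
  cases f with
  | inp i =>
    rw [foldr_update_of_notMem _ _ _ _ _ (by simp)]
    by_cases h : i < n
    · have := foldr_update_apply (fun i : Fin n => Focus.inp i) (fun i => .br (b i)) hinp
        (List.finRange n) (Function.update (fun _ => .empty) .out (.br false)) ⟨i, h⟩ (by simp)
      simpa [services, avail, initState, h] using this
    · rw [foldr_update_of_notMem _ _ _ _ _ (by
        rintro j - hj
        simp only [Focus.inp.injEq] at hj
        exact h (hj ▸ j.2))]
      simp [services, avail, h]
  | aux i =>
    by_cases h : i < l
    · rw [foldr_update_apply _ _ haux _ _ _ (by simpa using h)]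
      simp [services, avail, initState, h]
    · rw [foldr_update_of_notMem _ _ _ _ _ (by
        rintro j hj hji
        simp only [Focus.aux.injEq] at hji
        exact h (hji ▸ List.mem_range.1 hj)), foldr_update_of_notMem _ _ _ _ _ (by simp)]
      simp [services, avail, h]
  | out =>
    rw [foldr_update_of_notMem _ _ _ _ _ (by simp), foldr_update_of_notMem _ _ _ _ _ (by simp)]
    simp [services, avail, initState]

/-- All subthreads of the thread belong to `T`, and all registers that it accesses to `F`. -/
def Thread.Within (T : Set Thread) (F : Set Focus) : Thread → Prop
  | .dead => .dead ∈ T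
  | .done => .done ∈ T
  | .tau x => .tau x ∈ T ∧ x.Within T F
  | .post x a y => .post x a y ∈ T ∧ a.focus ∈ F ∧ x.Within T F ∧ y.Within T F

theorem Thread.Within.mem {T : Set Thread} {F : Set Focus} {x : Thread} (h : x.Within T F) :
    x ∈ T := by
  cases x with
  | dead => exact h
  | done => exact h
  | tau x => exact h.1
  | post x a y => exact h.1

theorem exec_post_services {A : Focus → Prop} {a : Basic} (ha : A a.focus) (x y : Thread)
    (s : Focus → Bool) :
    exec (.post x a y) (services A s) =
      if a.value s then exec x (services A (a.effect s))
      else exec y (services A (a.effect s)) := by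
  have h1 : services A s a.focus = .br (s a.focus) := by simp [services, ha]
  have h2 : Function.update (services A s) a.focus (.br (a.value s)) =
      services A (a.effect s) := by
    funext f
    by_cases hf : f = a.focus
    · subst hf; simp [services, ha, Basic.effect]
    · simp [services, hf, Basic.effect]
  obtain ⟨f, m⟩ := a
  cases m with
  | set b =>
    rw [exec, h1]
    cases b <;> simpa [Service.reply, Service.derive, Basic.value] using congrArg _ h2
  | get =>
    rw [exec, h1]
    simp only [Service.reply, Service.derive]
    rw [show s f = Basic.value ⟨f, .get⟩ s from rfl, h2]
    cases Basic.value ⟨f, .get⟩ s <;> rfl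

/-- A blocked action makes the result empty, so a Boolean result shows that every register accessed
was available. Availability can then be forgotten, and with it the number of auxiliary registers. -/
theorem run_of_exec {A : Focus → Prop} {x : Thread} {s : Focus → Bool} {v : Bool}
    (h : exec x (services A s) = .br v) : run x s = some v := by
  induction x generalizing s with
  | dead => simp [exec] at h
  | done =>
    simp only [exec, services] at h
    split at h <;> simp_all [run]
  | tau x ih => exact ih h
  | post x a y ihx ihy =>
    by_cases ha : A a.focus
    · rw [exec_post_services ha] at h
      rw [run]
      split_ifs at h ⊢
      · exact ihx h
      · exact ihy h
    · simp [exec, services, ha, Service.reply] at h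

theorem exec_of_run {T : Set Thread} {A : Focus → Prop} (hA : A .out) {x : Thread}
    (hx : x.Within T {f | A f}) {s : Focus → Bool} {v : Bool} (h : run x s = some v) :
    exec x (services A s) = .br v := by
  induction x generalizing s with
  | dead => simp [run] at h
  | done => simp_all [run, exec, services]
  | tau x ih => exact ih hx.2 h
  | post x a y ihx ihy =>
    rw [exec_post_services (show A a.focus from hx.2.1)]
    rw [run] at h
    split_ifs at h ⊢
    · exact ihx hx.2.2.1 h
    · exact ihy hx.2.2.2 h

theorem Computes.run_eq {X : List Instr} {n : ℕ} {f : BoolFun n} (h : Computes X f)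
    (b : Fin n → Bool) : run (extract X) (initState b) = some (f b) := by
  obtain ⟨l, hl⟩ := h
  exact run_of_exec ((apply_useInp_useAux b l _).symm.trans (hl b))

theorem computes_of_run {X : List Instr} {n : ℕ} {f : BoolFun n} (l : ℕ)
    (hX : (extract X).Within Set.univ {g | avail n l g})
    (h : ∀ b, run (extract X) (initState b) = some (f b)) : Computes X f :=
  ⟨l, fun b => (apply_useInp_useAux b l _).trans (exec_of_run trivial hX (h b))⟩

/-! ### Subthreads and depth of extracted threads -/

/-- The register accessed by an instruction. -/
def Instr.focus? : Instr → Option Focus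
  | .plain a => some a.focus
  | .ptst a => some a.focus
  | .ntst a => some a.focus
  | .jump _ => none
  | .halt => none

/-- Every subthread of an extracted thread is again the behaviour of a suffix of `X`. A thread whose
tree is exponentially large thus has only linearly many different subthreads. -/
theorem within_extractFrom {T : Set Thread} {F : Set Focus} (X : List Instr)
    (hT : ∀ k, extractFrom k X ∈ T) (hF : ∀ u ∈ X, ∀ f ∈ u.focus?, f ∈ F) (k : ℕ) :
    (extractFrom k X).Within T F := by
  induction X generalizing k with
  | nil => simpa [extractFrom, Thread.Within] using hT 0
  | cons u X ih =>
    have ih' := ih (fun k => by simpa [extractFrom] using hT (k + 1))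
      (fun u hu => hF u (by simp [hu]))
    have h0 := hT 0
    have hu := hF u (by simp)
    cases k with
    | succ k => simpa [extractFrom] using ih' k
    | zero =>
      cases u with
      | plain a =>
        simp only [extractFrom] at h0 ⊢
        exact ⟨h0, hu _ rfl, ih' _, ih' _⟩
      | ptst a =>
        simp only [extractFrom] at h0 ⊢
        exact ⟨h0, hu _ rfl, ih' _, ih' _⟩
      | ntst a =>
        simp only [extractFrom] at h0 ⊢
        exact ⟨h0, hu _ rfl, ih' _, ih' _⟩
      | jump l =>
        cases l with
        | zero => simpa [extractFrom, Thread.Within] using h0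
        | succ l => simpa [extractFrom] using ih' l
      | halt => simpa [extractFrom, Thread.Within] using h0

/-- The maximal number of steps of a thread. -/
def Thread.depth : Thread → ℕ
  | .dead => 0
  | .done => 0
  | .tau x => x.depth + 1
  | .post x _ y => max x.depth y.depth + 1

/-- Execution only moves forward, so each step uses up at least one instruction. -/
theorem depth_extractFrom_le (X : List Instr) (k : ℕ) :
    (extractFrom k X).depth ≤ X.length := by
  induction X generalizing k with
  | nil => simp [extractFrom, Thread.depth]
  | cons u X ih =>
    have h0 := ih 0
    have h1 := ih 1
    cases k with
    | succ k => simpa [extractFrom] using (ih k).trans (Nat.le_succ _)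
    | zero =>
      cases u with
      | plain a => simp only [extractFrom, Thread.depth, List.length_cons]; omega
      | ptst a => simp only [extractFrom, Thread.depth, List.length_cons]; omega
      | ntst a => simp only [extractFrom, Thread.depth, List.length_cons]; omega
      | jump l =>
        cases l with
        | zero => simp [extractFrom, Thread.depth]
        | succ l => simpa [extractFrom] using (ih l).trans (Nat.le_succ _)
      | halt => simp [extractFrom, Thread.depth]

theorem extractFrom_of_length_le (X : List Instr) (k : ℕ) (h : X.length ≤ k) :
    extractFrom k X = .dead := by
  induction X generalizing k with
  | nil => simp [extractFrom]
  | cons u X ih =>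
    cases k with
    | zero => simp at h
    | succ k => simpa [extractFrom] using ih k (by simpa using h)

theorem extractFrom_length_append (X Y : List Instr) :
    extractFrom X.length (X ++ Y) = extract Y := by
  induction X with
  | nil => rfl
  | cons u X ih => simpa [extractFrom] using ih

/-! ### Computing formulas in conjunctive normal form over the inputs -/

/-- The test of a literal on the input registers. -/
def litTest (x : Literal) : Instr :=
  if x.2 then .ptst ⟨.inp x.1, .get⟩ else .ntst ⟨.inp x.1, .get⟩

/-- Code that proceeds after its end if some literal is true, and terminates otherwise. -/
def clauseCode : List Literal → List Instr
  | [] => [.halt]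
  | x :: xs => litTest x :: .jump ((clauseCode xs).length + 1) :: clauseCode xs

/-- Code that computes a formula in conjunctive normal form over the input registers. -/
def cnfCode : List (List Literal) → List Instr
  | [] => [.plain ⟨.out, .set true⟩, .halt]
  | c :: cs => clauseCode c ++ cnfCode cs

/-- A true literal leads to the jump past the rest of the clause code, and a false one skips that
jump. Only if all literals are false is the final `!` reached. -/
theorem run_clauseCode (c : List Literal) (Y : List Instr) (s : Focus → Bool) :
    run (extract (clauseCode c ++ Y)) s =
      if ∃ x ∈ c, s (.inp x.1) = x.2 then run (extract Y) s else some (s .out) := by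
  induction c with
  | nil => simp [clauseCode, extract_halt, run]
  | cons x c ih =>
    obtain ⟨i, p⟩ := x
    have he : Basic.effect ⟨.inp i, .get⟩ s = s := by simp [Basic.effect, Basic.value]
    have hmem : (∃ x ∈ (i, p) :: c, s (.inp x.1) = x.2) ↔
        s (.inp i) = p ∨ ∃ x ∈ c, s (.inp x.1) = x.2 := List.exists_mem_cons_iff ..
    simp only [hmem]
    rw [extract] at ih
    cases p <;> cases hs : s (.inp i) <;>
      simp [clauseCode, litTest, extract, extractFrom, run, he, Basic.value, hs,
        extractFrom_length_append, ih] <;>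
      exact if_congr (by simp) rfl rfl

theorem run_cnfCode (cs : List (List Literal)) (s : Focus → Bool) (hs : s .out = false) :
    run (extract (cnfCode cs)) s =
      some (decide (∀ c ∈ cs, ∃ x ∈ c, s (.inp x.1) = x.2)) := by
  induction cs with
  | nil => simp [cnfCode, extract, extractFrom, run, Basic.value, Basic.effect]
  | cons c cs ih =>
    rw [cnfCode, run_clauseCode, ih, hs]
    split_ifs with h
    · simp only [List.forall_mem_cons, h, true_and]
    · simp only [List.forall_mem_cons, h, false_and, decide_false]

theorem length_clauseCode (c : List Literal) : (clauseCode c).length = 2 * c.length + 1 := by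
  induction c with
  | nil => rfl
  | cons x c ih => simp only [clauseCode, List.length_cons, ih]; omega

theorem length_cnfCode_le (cs : List (List Literal)) (k : ℕ) (h : ∀ c ∈ cs, c.length ≤ k) :
    (cnfCode cs).length ≤ (2 * k + 1) * cs.length + 2 := by
  induction cs with
  | nil => simp [cnfCode]
  | cons c cs ih =>
    rw [List.forall_mem_cons] at h
    have := ih h.2
    rw [cnfCode, List.length_append, length_clauseCode, List.length_cons, mul_add]
    omega

theorem forall_mem_clauseCode {P : Instr → Prop} (c : List Literal) (hh : P .halt)
    (hj : ∀ l, P (.jump l)) (ht : ∀ x ∈ c, P (litTest x)) : ∀ u ∈ clauseCode c, P u := by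
  induction c with
  | nil => simpa [clauseCode] using hh
  | cons x c ih =>
    rw [List.forall_mem_cons] at ht
    simp only [clauseCode, List.forall_mem_cons]
    exact ⟨ht.1, hj _, ih ht.2⟩

theorem forall_mem_cnfCode {P : Instr → Prop} (cs : List (List Literal)) (hh : P .halt)
    (ho : P (.plain ⟨.out, .set true⟩)) (hj : ∀ l, P (.jump l))
    (ht : ∀ c ∈ cs, ∀ x ∈ c, P (litTest x)) : ∀ u ∈ cnfCode cs, P u := by
  induction cs with
  | nil => simpa [cnfCode] using ⟨ho, hh⟩
  | cons c cs ih =>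
    rw [List.forall_mem_cons] at ht
    simp only [cnfCode, List.forall_mem_append]
    exact ⟨forall_mem_clauseCode c hh hj ht.1, ih ht.2⟩

theorem cnfCode_mem_ISbr (cs : List (List Literal)) : cnfCode cs ∈ ISbr := by
  constructor
  · cases cs with
    | nil => simp [cnfCode]
    | cons c cs => cases c <;> simp [cnfCode, clauseCode]
  · refine forall_mem_cnfCode cs trivial trivial (fun _ => trivial) fun c _ x _ => ?_
    unfold litTest
    split_ifs <;> trivial

theorem computes_cnfCode {n : ℕ} (cs : List (List Literal)) (hcs : ∀ c ∈ cs, ∀ x ∈ c, x.1 < n)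
    (f : BoolFun n)
    (hf : ∀ b, f b = true ↔ ∀ c ∈ cs, ∃ x ∈ c, initState b (.inp x.1) = x.2) :
    Computes (cnfCode cs) f := by
  refine computes_of_run 0 (within_extractFrom _ (fun _ => Set.mem_univ _) ?_ 0) fun b => ?_
  · refine forall_mem_cnfCode cs (by simp [Instr.focus?]) ?_ (by simp [Instr.focus?]) ?_
    · simp [Instr.focus?, avail]
    · intro c hc x hx
      have := hcs c hc x hx
      unfold litTest
      split_ifs <;> simpa [Instr.focus?, avail] using this
  · rw [run_cnfCode _ _ rfl, Option.some_inj, Bool.eq_iff_iff, hf b, decide_eq_true_iff]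

/-! ### Polynomially bounded functions -/

/-- The base `n + 1` keeps the power positive at `n = 0`, which allows a bound for all `n` in place
of an asymptotic one. -/
theorem mem_poly_iff {h : ℕ → ℕ} : h ∈ poly ↔ ∃ C k : ℕ, ∀ n, h n ≤ C * (n + 1) ^ k := by
  constructor
  · rintro ⟨k, hk⟩
    obtain ⟨c, hc⟩ := hk.bound
    obtain ⟨N, hN⟩ := Filter.eventually_atTop.1 hc
    -- The sum absorbs the finitely many values below the threshold `N`.
    refine ⟨⌈c⌉₊ + ∑ i ∈ Finset.range N, h i, k, fun n => ?_⟩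
    have hpos : 1 ≤ (n + 1) ^ k := Nat.one_le_pow _ _ (Nat.succ_pos n)
    rcases lt_or_ge n N with hn | hn
    · calc h n ≤ ∑ i ∈ Finset.range N, h i :=
            Finset.single_le_sum (f := h) (fun _ _ => Nat.zero_le _) (Finset.mem_range.2 hn)
        _ ≤ (⌈c⌉₊ + ∑ i ∈ Finset.range N, h i) * 1 := by omega
        _ ≤ _ := Nat.mul_le_mul_left _ hpos
    · have h1 := hN n hn
      simp only [Real.norm_eq_abs, Nat.abs_cast, abs_pow] at h1
      have h2 : (h n : ℝ) ≤ ((⌈c⌉₊ * n ^ k : ℕ) : ℝ) := by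
        push_cast
        exact h1.trans (mul_le_mul_of_nonneg_right (Nat.le_ceil c) (by positivity))
      calc h n ≤ ⌈c⌉₊ * n ^ k := by exact_mod_cast h2
        _ ≤ _ := Nat.mul_le_mul (Nat.le_add_right _ _) (Nat.pow_le_pow_left (Nat.le_succ n) k)
  · rintro ⟨C, k, hC⟩
    refine ⟨k, Asymptotics.IsBigO.of_bound (C * 2 ^ k : ℝ) ?_⟩
    filter_upwards [Filter.eventually_ge_atTop 1] with n hn
    have h1 : h n ≤ C * 2 ^ k * n ^ k := by
      calc h n ≤ C * (n + 1) ^ k := hC n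
        _ ≤ C * (2 * n) ^ k := Nat.mul_le_mul_left _ (Nat.pow_le_pow_left (by omega) k)
        _ = _ := by rw [mul_pow, mul_assoc]
    simp only [Real.norm_eq_abs, Nat.abs_cast, abs_pow]
    exact_mod_cast h1

theorem poly_mono {f g : ℕ → ℕ} (hg : g ∈ poly) (h : ∀ n, f n ≤ g n) : f ∈ poly := by
  rw [mem_poly_iff] at *
  obtain ⟨C, k, hC⟩ := hg
  exact ⟨C, k, fun n => (h n).trans (hC n)⟩

theorem const_mem_poly (c : ℕ) : (fun _ => c) ∈ poly :=
  mem_poly_iff.2 ⟨c, 0, by simp⟩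

theorem id_mem_poly : (fun n => n) ∈ poly :=
  mem_poly_iff.2 ⟨1, 1, by simp⟩

theorem mul_mem_poly {f g : ℕ → ℕ} (hf : f ∈ poly) (hg : g ∈ poly) :
    (fun n => f n * g n) ∈ poly := by
  rw [mem_poly_iff] at *
  obtain ⟨C, k, hC⟩ := hf
  obtain ⟨D, l, hD⟩ := hg
  refine ⟨C * D, k + l, fun n => (Nat.mul_le_mul (hC n) (hD n)).trans_eq ?_⟩
  ring

theorem add_mem_poly {f g : ℕ → ℕ} (hf : f ∈ poly) (hg : g ∈ poly) :
    (fun n => f n + g n) ∈ poly := by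
  rw [mem_poly_iff] at *
  obtain ⟨C, k, hC⟩ := hf
  obtain ⟨D, l, hD⟩ := hg
  refine ⟨C + D, k + l, fun n => ?_⟩
  have hn : 0 < n + 1 := Nat.succ_pos n
  calc f n + g n ≤ C * (n + 1) ^ k + D * (n + 1) ^ l := Nat.add_le_add (hC n) (hD n)
    _ ≤ C * (n + 1) ^ (k + l) + D * (n + 1) ^ (k + l) :=
      Nat.add_le_add (Nat.mul_le_mul_left _ (Nat.pow_le_pow_right hn (Nat.le_add_right _ _)))
        (Nat.mul_le_mul_left _ (Nat.pow_le_pow_right hn (Nat.le_add_left _ _)))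
    _ = _ := by ring

theorem pow_mem_poly {f : ℕ → ℕ} (hf : f ∈ poly) (k : ℕ) : (fun n => f n ^ k) ∈ poly := by
  induction k with
  | zero => simpa using const_mem_poly 1
  | succ k ih => simpa only [pow_succ] using mul_mem_poly ih hf

theorem comp_mem_poly {f g : ℕ → ℕ} (hf : f ∈ poly) (hg : g ∈ poly) :
    (fun n => f (g n)) ∈ poly := by
  obtain ⟨C, k, hC⟩ := mem_poly_iff.1 hf
  exact poly_mono (mul_mem_poly (const_mem_poly C)
    (pow_mem_poly (add_mem_poly hg (const_mem_poly 1)) k)) fun n => hC (g n)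

theorem ndisj_mem_poly {f : ℕ → ℕ} (hf : f ∈ poly) : (fun n => ndisj (f n)) ∈ poly := by
  have h2 := mul_mem_poly (const_mem_poly 2) hf
  refine poly_mono (add_mem_poly (add_mem_poly (pow_mem_poly h2 1) (pow_mem_poly h2 2))
    (pow_mem_poly h2 3)) fun n => ?_
  exact add_le_add (add_le_add (Nat.choose_le_pow _ _) (Nat.choose_le_pow _ _))
    (Nat.choose_le_pow _ _)

theorem ndisj_lt_succ (k : ℕ) : ndisj k < ndisj (k + 1) := by
  have h : 2 * k ≤ 2 * (k + 1) := by omega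
  have h1 := Nat.choose_le_choose 2 h
  have h2 := Nat.choose_le_choose 3 h
  simp only [ndisj, Nat.choose_one_right] at *
  omega

theorem level_ndisj (k : ℕ) : level (ndisj k) = k := level_eq le_rfl (ndisj_lt_succ k)

theorem level_le (n : ℕ) : level n ≤ n := Nat.findGreatest_le n

/-! ### Observing executions -/

/-- One step of execution. -/
def step : Thread × (Focus → Bool) → Thread × (Focus → Bool)
  | (.tau x, s) => (x, s)
  | (.post x a y, s) => (if a.value s then x else y, a.effect s)
  | c => c

theorem run_step (c : Thread × (Focus → Bool)) : run (step c).1 (step c).2 = run c.1 c.2 := by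
  obtain ⟨x, s⟩ := c
  cases x with
  | post x a y => simp only [step, run]; split_ifs <;> rfl
  | _ => rfl

theorem run_iterate_step (t : ℕ) (c : Thread × (Focus → Bool)) :
    run (step^[t] c).1 (step^[t] c).2 = run c.1 c.2 := by
  induction t with
  | zero => rfl
  | succ t ih => rw [Function.iterate_succ_apply', run_step, ih]

/-- What can be observed of an execution: whether a given thread remains to be executed after `t`
steps, and the content of a given register after `t` steps. -/
abbrev Observable : Type := ℕ × (Thread ⊕ Focus)

open Classical in
/-- The observations made if `x` is executed from the state `s`. -/
noncomputable def observe (x : Thread) (s : Focus → Bool) : Observable → Bool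
  | (t, .inl y) => decide ((step^[t] (x, s)).1 = y)
  | (t, .inr f) => (step^[t] (x, s)).2 f

/-- On any three elements of `V`, the function `σ` agrees with a member of `A`. -/
def LocallyConsistent {ι : Type*} (V : Set ι) (A : Set (ι → Bool)) (σ : ι → Bool) : Prop :=
  ∀ u ∈ V, ∀ v ∈ V, ∀ w ∈ V, ∃ τ ∈ A, τ u = σ u ∧ τ v = σ v ∧ τ w = σ w

/-- An implication with two premises involves three observations, so local consistency carries it
from `A` to `σ`. The member of `A` comes from local consistency itself, so `A` need not be assumed
non-empty. -/
theorem LocallyConsistent.imp {ι : Type*} {V : Set ι} {A : Set (ι → Bool)} {σ : ι → Bool}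
    (hσ : LocallyConsistent V A σ) {u v w : ι} (hu : u ∈ V) (hv : v ∈ V) (hw : w ∈ V)
    {p q r : Bool} (h : ∀ τ ∈ A, τ u = p → τ v = q → τ w = r) (hp : σ u = p) (hq : σ v = q) :
    σ w = r := by
  obtain ⟨τ, hτ, h1, h2, h3⟩ := hσ u hu v hv w hw
  rw [← h3]
  exact h τ hτ (h1.trans hp) (h2.trans hq)

/-- Observations that are locally consistent with the executions that output `true` belong to
such an execution. -/
theorem run_eq_true_of_locallyConsistent {T : Set Thread} {F : Set Focus} (hout : .out ∈ F)
    {L : ℕ} {x₀ : Thread} (hx₀ : x₀.Within T F) (hL : x₀.depth ≤ L) {V : Set Observable}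
    (hVT : ∀ t ≤ L, ∀ y ∈ T, (t, .inl y) ∈ V) (hVF : ∀ t ≤ L, ∀ f ∈ F, (t, .inr f) ∈ V)
    {A : Set (Observable → Bool)}
    (hA : ∀ τ ∈ A, ∃ s, run x₀ s = some true ∧ observe x₀ s = τ)
    {σ : Observable → Bool} (hσ : LocallyConsistent V A σ)
    {s : Focus → Bool} (hs : ∀ f ∈ F, s f = σ (0, .inr f)) {v : Bool} (hv : run x₀ s = some v) :
    v = true := by
  suffices key : ∀ (x : Thread) (t : ℕ) (s : Focus → Bool), x.Within T F → t + x.depth ≤ L →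
      σ (t, .inl x) = true → (∀ f ∈ F, s f = σ (t, .inr f)) → run x s = some v → v = true by
    refine key x₀ 0 s hx₀ (by omega) ?_ hs hv
    have h0 := hVT 0 (Nat.zero_le _) x₀ hx₀.mem
    refine hσ.imp h0 h0 h0 (p := σ (0, .inl x₀)) (q := σ (0, .inl x₀)) ?_ rfl rfl
    intro τ hτ _ _
    obtain ⟨s', -, rfl⟩ := hA τ hτ
    simp [observe]
  intro x
  induction x with
  | dead => intro t s _ _ _ _ h; simp [run] at h
  | done =>
    intro t s hx ht hpos hs h
    have hso : s .out = v := by simpa [run] using h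
    rw [← hso, hs _ hout]
    have h1 := hVT t (by omega) _ hx.mem
    refine hσ.imp h1 h1 (hVF t (by omega) _ hout) ?_ hpos hpos
    intro τ hτ h2 _
    obtain ⟨s', hs', rfl⟩ := hA τ hτ
    -- Every run in `A` outputs true, so one that has reached termination already has true in `out`.
    have h3 := run_iterate_step t (x₀, s')
    simp only [observe, decide_eq_true_eq] at h2 ⊢
    rw [h2, hs'] at h3
    simpa [run] using h3
  | tau x ih =>
    intro t s hx ht hpos hs h
    simp only [Thread.depth] at ht
    have h1 := hVT t (by omega) _ hx.mem
    refine ih (t + 1) s hx.2 (by omega) ?_ (fun f hf => ?_) h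
    · refine hσ.imp h1 h1 (hVT (t + 1) (by omega) _ hx.2.mem) ?_ hpos hpos
      intro τ hτ h2 _
      obtain ⟨s', hs', rfl⟩ := hA τ hτ
      simp only [observe, decide_eq_true_eq, Function.iterate_succ_apply'] at h2 ⊢
      generalize step^[t] (x₀, s') = c at h2 ⊢
      obtain ⟨y, s'⟩ := c
      subst h2
      rfl
    · symm
      refine hσ.imp h1 (hVF t (by omega) f hf) (hVF (t + 1) (by omega) f hf) ?_ hpos
        (hs f hf).symm
      intro τ hτ h2 h3
      obtain ⟨s', hs', rfl⟩ := hA τ hτ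
      simp only [observe, decide_eq_true_eq, Function.iterate_succ_apply'] at h2 h3 ⊢
      generalize step^[t] (x₀, s') = c at h2 h3 ⊢
      obtain ⟨y, s'⟩ := c
      subst h2
      exact h3
  | post x a y ihx ihy =>
    intro t s hx ht hpos hs h
    simp only [Thread.depth] at ht
    have h1 := hVT t (by omega) _ hx.mem
    -- The new content of `f` is determined by the current thread and the old content of `f` alone:
    -- `set` writes a constant and `get` changes nothing.
    have hcont : ∀ f ∈ F, a.effect s f = σ (t + 1, .inr f) := by
      intro f hf
      symm
      refine hσ.imp h1 (hVF t (by omega) f hf) (hVF (t + 1) (by omega) f hf) ?_ hpos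
        (hs f hf).symm
      intro τ hτ h2 h3
      obtain ⟨s', hs', rfl⟩ := hA τ hτ
      simp only [observe, decide_eq_true_eq, Function.iterate_succ_apply'] at h2 h3 ⊢
      generalize step^[t] (x₀, s') = c at h2 h3 ⊢
      obtain ⟨z, s'⟩ := c
      subst h2
      by_cases hfa : f = a.focus
      · subst hfa
        simp only [step, Basic.effect, Function.update_self]
        cases hm : a.method <;> simp_all [Basic.value]
      · simpa [step, Basic.effect, hfa] using h3
    -- The next thread is determined by the current thread and the content of the one register that
    -- it accesses.
    have hpos' : σ (t + 1, .inl (if a.value s then x else y)) = true := by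
      refine hσ.imp h1 (hVF t (by omega) _ hx.2.1) (hVT (t + 1) (by omega) _ ?_) ?_ hpos
        (hs _ hx.2.1).symm
      · split_ifs
        exacts [hx.2.2.1.mem, hx.2.2.2.mem]
      · intro τ hτ h2 h3
        obtain ⟨s', hs', rfl⟩ := hA τ hτ
        simp only [observe, decide_eq_true_eq, Function.iterate_succ_apply'] at h2 h3 ⊢
        generalize step^[t] (x₀, s') = c at h2 h3 ⊢
        obtain ⟨z, s'⟩ := c
        subst h2
        have : a.value s' = a.value s := by cases hm : a.method <;> simp_all [Basic.value]
        simp only [step, this]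
    rw [run] at h
    split_ifs at h hpos' with hr
    · exact ihx (t + 1) _ hx.2.2.1 (by omega) hpos' hcont h
    · exact ihy (t + 1) _ hx.2.2.2 (by omega) hpos' hcont h

/-! ### Reductions to 3SATC -/

theorem threeSATC_ndisj (α : ∀ k, Fin (ndisj k) ≃ Clause k) (k : ℕ) (b : Fin (ndisj k) → Bool) :
    threeSATC α (ndisj k) b = true ↔ Satisfiable α k b := by
  -- The level of `ndisj k` equals `k` only propositionally; with a general `j` the equality can be
  -- substituted in the dependent types.
  have key : ∀ (j : ℕ) (hle : ndisj j ≤ ndisj k), j = k →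
      (Satisfiable α j (fun i => b (Fin.castLE hle i)) ↔ Satisfiable α k b) := by
    rintro j hle rfl
    rfl
  simpa only [threeSATC, decide_eq_true_iff] using key _ (ndisj_level_le _) (level_ndisj k)

/-- An assignment that satisfies all clauses of at most three literals that hold in `A` is locally
consistent with `A`. -/
theorem locallyConsistent_of_clauses {k : ℕ} {A : Set (ℕ → Bool)} {σ : ℕ → Bool}
    (h : ∀ C : Clause k, (∀ τ ∈ A, ∃ x ∈ C.1, τ x.1 = x.2) → ∃ x ∈ C.1, σ x.1 = x.2) :
    LocallyConsistent {j | j < k} A σ := by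
  intro u hu v hv w hw
  by_contra! hc
  -- If no member of `A` has the values of `σ` at `u`, `v`, `w`, the clause denying these values
  -- holds throughout `A` and hence at `σ`, which is absurd. Coinciding indices merely give a
  -- shorter clause.
  obtain ⟨x, hx, hxσ⟩ := h ⟨{(u, !σ u), (v, !σ v), (w, !σ w)}, by
      simpa using ⟨hu, hv, hw⟩, Finset.card_pos.2 (Finset.insert_nonempty _ _),
      Finset.card_le_three⟩ (by
    intro τ hτ
    by_contra! hn
    simp only [Finset.mem_insert, Finset.mem_singleton, forall_eq_or_imp, forall_eq, ne_eq,
      Bool.not_eq_not] at hn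
    exact hc τ hτ (by simpa using hn.1) (by simpa using hn.2.1) (by simpa using hn.2.2))
  simp only [Finset.mem_insert, Finset.mem_singleton] at hx
  rcases hx with rfl | rfl | rfl <;> simp at hxσ

/-- The clauses switched on are those valid in `A` and the unit clauses expressing the input `w`.
Validity in `A` does not depend on `w`, so it costs no instructions. -/
theorem lengthReducible_threeSATC (α : ∀ k, Fin (ndisj k) ≃ Clause k) {n k : ℕ} (f : BoolFun n)
    (A : Set (ℕ → Bool)) (iv : Fin n → ℕ) (hinj : Function.Injective iv) (hlt : ∀ i, iv i < k)
    (h₁ : ∀ w, f w = true → ∃ σ ∈ A, ∀ i, σ (iv i) = w i)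
    (h₂ : ∀ w σ, LocallyConsistent {j | j < k} A σ → (∀ i, σ (iv i) = w i) → f w = true) :
    LengthReducible ISbr 5 f (threeSATC α (ndisj k)) := by
  classical
  let H : Fin (ndisj k) → BoolFun n := fun j w =>
    decide ((∀ τ ∈ A, ∃ x ∈ (α k j).1, τ x.1 = x.2) ∨ ∃ i, (α k j).1 = {(iv i, w i)})
  refine ⟨H, fun j => ?_, fun w => ?_⟩
  · suffices ∃ cs : List (List Literal), cs.length ≤ 1 ∧ (∀ c ∈ cs, c.length ≤ 1) ∧
        (∀ c ∈ cs, ∀ x ∈ c, x.1 < n) ∧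
        ∀ w, H j w = true ↔ ∀ c ∈ cs, ∃ x ∈ c, initState w (.inp x.1) = x.2 by
      obtain ⟨cs, h1, h2, h3, h4⟩ := this
      refine ⟨cnfCode cs, cnfCode_mem_ISbr cs, computes_cnfCode cs h3 _ h4, ?_⟩
      have := length_cnfCode_le cs 1 h2
      omega
    by_cases hA : ∀ τ ∈ A, ∃ x ∈ (α k j).1, τ x.1 = x.2
    · exact ⟨[], by simp, by simp, by simp, fun w => by
        simp only [H, decide_eq_true_iff, List.not_mem_nil, false_imp_iff, implies_true, iff_true]
        exact Or.inl hA⟩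
    by_cases hu : ∃ i p, (α k j).1 = {(iv i, p)}
    · obtain ⟨i, p, hp⟩ := hu
      refine ⟨[[(i, p)]], by simp, by simp, by simp only [List.mem_singleton, forall_eq, i.2],
        fun w => ?_⟩
      simp only [H, decide_eq_true_iff, or_iff_right hA]
      simp only [hp, Finset.singleton_inj, Prod.mk.injEq,
        List.mem_singleton, forall_eq, exists_eq_left, initState, i.2, dite_true, Fin.eta]
      constructor
      · rintro ⟨i', hi, rfl⟩
        rw [hinj hi]
      · rintro rfl
        exact ⟨i, rfl, rfl⟩
    · refine ⟨[[]], by simp, by simp, by simp, fun w => ?_⟩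
      simp only [H, decide_eq_true_iff, or_iff_right hA]
      simpa using fun i hi => hu ⟨i, _, hi⟩
  · rw [Bool.eq_iff_iff, threeSATC_ndisj]
    constructor
    · intro hw
      obtain ⟨σ, hσ, hσw⟩ := h₁ w hw
      refine ⟨σ, fun j hj => ?_⟩
      rcases of_decide_eq_true hj with h | ⟨i, hi⟩
      · exact h σ hσ
      · exact ⟨_, hi ▸ Finset.mem_singleton_self _, hσw i⟩
    · rintro ⟨σ, hσ⟩
      have hσ' : ∀ C : Clause k, ((∀ τ ∈ A, ∃ x ∈ C.1, τ x.1 = x.2) ∨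
          ∃ i, C.1 = {(iv i, w i)}) → ∃ x ∈ C.1, σ x.1 = x.2 := by
        intro C hC
        obtain ⟨j, rfl⟩ := (α k).surjective C
        exact hσ j (decide_eq_true hC)
      refine h₂ w σ (locallyConsistent_of_clauses fun C hC => hσ' C (Or.inl hC)) fun i => ?_
      simpa using hσ' ⟨{(iv i, w i)}, by simpa using hlt i, by simp, by simp⟩ (Or.inr ⟨i, rfl⟩)

/-- The bound counts observations: `X.length + 1` times, each with at most `X.length + 1` threads
and `X.length + n + 1` registers. -/
theorem lengthReducible_threeSATC_of_computes (α : ∀ k, Fin (ndisj k) ≃ Clause k) {n m : ℕ}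
    {f : BoolFun n} {g : BoolFun (n + m)}
    (hfg : ∀ w, f w = true ↔ ∃ c : Fin m → Bool, g (Fin.append w c) = true)
    {X : List Instr} (hX : Computes X g) :
    ∃ k ≤ (X.length + 1) * (2 * X.length + n + 2),
      LengthReducible ISbr 5 f (threeSATC α (ndisj k)) := by
  classical
  set L := X.length with hL
  let T : Finset Thread := (Finset.range (L + 1)).image fun p => extractFrom p X
  -- Besides the registers accessed by `X`, `out` is needed for the result and the first `n` inputs
  -- for the unit clauses.
  let F : Finset Focus :=
    insert .out ((X.filterMap Instr.focus?).toFinset ∪ (Finset.range n).image Focus.inp)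
  let V : Finset Observable := Finset.range (L + 1) ×ˢ T.disjSum F
  have hVT : ∀ t ≤ L, ∀ y ∈ T, (t, .inl y) ∈ V := by
    intro t ht y hy
    simpa [V] using ⟨ht, hy⟩
  have hVF : ∀ t ≤ L, ∀ f ∈ F, (t, .inr f) ∈ V := by
    intro t ht y hy
    simpa [V] using ⟨ht, hy⟩
  have hout : Focus.out ∈ F := Finset.mem_insert_self _ _
  have hinp : ∀ i : Fin n, Focus.inp i ∈ F := fun i => by simp [F]
  have hwithin : (extract X).Within (T : Set Thread) (F : Set Focus) := by
    refine within_extractFrom X (fun p => ?_) (fun u hu f hf => ?_) 0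
    · rcases le_or_gt L p with hp | hp
      · rw [extractFrom_of_length_le X p hp, ← extractFrom_of_length_le X L le_rfl]
        exact Finset.mem_image_of_mem _ (by simp)
      · exact Finset.mem_image_of_mem _ (by simp; omega)
    · refine Finset.mem_insert_of_mem (Finset.mem_union_left _ ?_)
      rw [List.mem_toFinset, List.mem_filterMap]
      exact ⟨u, hu, hf⟩
  refine ⟨V.card, ?_, ?_⟩
  · have hTc : T.card ≤ L + 1 := Finset.card_image_le.trans (by simp)
    have hFc : F.card ≤ L + n + 1 := by
      refine (Finset.card_insert_le _ _).trans (Nat.succ_le_succ ?_)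
      refine (Finset.card_union_le _ _).trans (Nat.add_le_add ?_ ?_)
      · exact (List.toFinset_card_le _).trans (List.length_filterMap_le _ _)
      · exact Finset.card_image_le.trans (by simp)
    simp only [V, Finset.card_product, Finset.card_range, Finset.card_disjSum]
    exact Nat.mul_le_mul_left _ (by omega)
  let e : V ≃ Fin V.card := V.equivFin
  let pull : (Observable → Bool) → ℕ → Bool := fun τ j =>
    if h : j < V.card then τ (e.symm ⟨j, h⟩) else false
  have hpull : ∀ τ (v : V), pull τ (e v) = τ v := fun τ v => by simp [pull]
  let iv : Fin n → V := fun i => ⟨(0, .inr (.inp i)), hVF 0 (Nat.zero_le _) _ (hinp i)⟩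
  let A : Set (Observable → Bool) :=
    {τ | ∃ b, g b = true ∧ observe (extract X) (initState b) = τ}
  have hA : ∀ τ ∈ A, ∃ s, run (extract X) s = some true ∧ observe (extract X) s = τ := by
    rintro _ ⟨b, hb, rfl⟩
    exact ⟨_, by rw [hX.run_eq, hb], rfl⟩
  refine lengthReducible_threeSATC α f
    (pull '' A)
    (fun i => e (iv i)) ?_ (fun i => (e (iv i)).2) ?_ ?_
  · intro i j hij
    have := e.injective (Fin.ext hij)
    simpa [iv, Fin.ext_iff] using this
  · intro w hw
    obtain ⟨c, hc⟩ := (hfg w).1 hw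
    refine ⟨_, ⟨_, ⟨Fin.append w c, hc, rfl⟩, rfl⟩, fun i => ?_⟩
    have hi : (i : ℕ) < n + m := by omega
    rw [hpull]
    simp only [iv, observe, Function.iterate_zero, id_eq, initState, hi, dite_true]
    exact Fin.append_left w c i
  · intro w σ hσ hσw
    let σ' : Observable → Bool := fun v => if h : v ∈ V then σ (e ⟨v, h⟩) else false
    have hσ' : ∀ v : V, σ' v = σ (e v) := fun v => by simp [σ']
    have hcons : LocallyConsistent (V : Set Observable) A σ' := by
      intro u hu v hv z hz
      obtain ⟨_, ⟨τ, hτ, rfl⟩, h1, h2, h3⟩ :=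
        hσ _ (e ⟨u, hu⟩).2 _ (e ⟨v, hv⟩).2 _ (e ⟨z, hz⟩).2
      rw [hpull, ← hσ'] at h1 h2 h3
      exact ⟨τ, hτ, h1, h2, h3⟩
    -- A register that starts as false in every run has value false in all of `A` at time 0, hence
    -- also under `σ'`.
    have hzero : ∀ f ∈ F, (∀ b : Fin (n + m) → Bool, initState b f = false) →
        false = σ' (0, .inr f) := by
      intro f hf hb
      have h0 := hVF 0 (Nat.zero_le _) f hf
      symm
      refine hcons.imp h0 h0 h0 ?_ rfl rfl
      rintro _ ⟨b, -, rfl⟩ - -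
      exact hb b
    -- The certificate is what `σ'` reports at time 0. Bits that are not observed get the default
    -- false, and `X` never reads them.
    refine (hfg w).2 ⟨fun i => σ' (0, .inr (.inp (n + i))), ?_⟩
    refine run_eq_true_of_locallyConsistent hout hwithin (depth_extractFrom_le X 0) hVT hVF hA
      hcons (fun f hf => ?_) (hX.run_eq _)
    cases f with
    | inp i =>
      by_cases hi : i < n + m
      · simp only [initState, hi, dite_true]
        rcases lt_or_ge i n with hin | hin
        · have h1 := hσ' (iv ⟨i, hin⟩)
          rw [hσw] at h1
          exact (Fin.append_left w _ ⟨i, hin⟩).trans h1.symm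
        · obtain ⟨i, rfl⟩ := Nat.exists_eq_add_of_le hin
          exact Fin.append_right w (fun i : Fin m => σ' (0, .inr (.inp (n + i))))
            ⟨i, by omega⟩
      · simpa [initState, hi] using hzero _ hf (by simp [initState, hi])
    | aux i => exact hzero _ hf (fun _ => rfl)
    | out => exact hzero _ hf (fun _ => rfl)

/-! ### Membership of 3SATC in NPLIS -/

theorem threeSATC_mem_NDNUC (α : ∀ k, Fin (ndisj k) ≃ Clause k) :
    threeSATC α ∈ NDNUC ISbr poly := by
  -- The negative literal on input `i` switches the clause off when it is absent; variable `j` is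
  -- certificate bit `j`, stored at input `n + j`.
  let cs : ℕ → List (List Literal) := fun n => (List.finRange (ndisj (level n))).map fun i : Fin _ =>
    ((i : ℕ), false) :: ((α (level n) i).1.toList.map fun x => (n + x.1, x.2))
  have hcs : ∀ (n : ℕ) (b : ℕ → Bool), (∀ c ∈ cs n, ∃ x ∈ c, b x.1 = x.2) ↔
      ∀ i : Fin _, b i = true → ∃ x ∈ (α (level n) i).1, b (n + x.1) = x.2 := by
    intro n b
    simp only [cs, List.mem_map, List.mem_finRange, true_and, forall_exists_index,
      forall_apply_eq_imp_iff, List.exists_mem_cons_iff]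
    refine forall_congr' fun i => ?_
    rw [← Bool.not_eq_true, ← imp_iff_not_or]
    simp only [exists_exists_and_eq_and, Finset.mem_toList]
  -- The certificate has length `n`, so the verifier is used at arity `m = n + n` and recovers `n`
  -- as `m / 2`; its values at odd arities play no role.
  let G : BoolFamily := fun m b =>
    @decide (∀ c ∈ cs (m / 2), ∃ x ∈ c, initState b (.inp x.1) = x.2) (Classical.propDecidable _)
  have hG : ∀ m b, G m b = true ↔
      ∀ c ∈ cs (m / 2), ∃ x ∈ c, initState b (.inp x.1) = x.2 := fun m b =>
    @decide_eq_true_iff _ (Classical.propDecidable _)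
  refine ⟨fun n => n, id_mem_poly, monotone_id, G, ⟨fun m => (2 * 4 + 1) * m + 2,
    add_mem_poly (mul_mem_poly (const_mem_poly _) id_mem_poly) (const_mem_poly _), fun m =>
    ⟨cnfCode (cs (m / 2)), cnfCode_mem_ISbr _, computes_cnfCode _ ?_ _ (hG m), ?_⟩⟩, ?_⟩
  · intro c hc x hx
    simp only [cs, List.mem_map, List.mem_finRange, true_and] at hc
    obtain ⟨i, rfl⟩ := hc
    have h1 := ndisj_level_le (m / 2)
    have h2 := level_le (m / 2)
    rw [List.mem_cons, List.mem_map] at hx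
    rcases hx with rfl | ⟨y, hy, rfl⟩
    · have := i.2
      dsimp only
      omega
    · have := (α (level (m / 2)) i).2.1 y (Finset.mem_toList.1 hy)
      dsimp only
      omega
  · refine (length_cnfCode_le _ 4 fun c hc => ?_).trans ?_
    · simp only [cs, List.mem_map, List.mem_finRange, true_and] at hc
      obtain ⟨i, rfl⟩ := hc
      simpa [Nat.lt_succ_iff] using (α (level (m / 2)) i).2.2.2
    · have h1 := ndisj_level_le (m / 2)
      have h2 : (cs (m / 2)).length ≤ m := by
        simp only [cs, List.length_map, List.length_finRange]
        omega
      dsimp only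
      omega
  · intro n w
    have hn : (n + n) / 2 = n := by omega
    have hw : ∀ (c : Fin n → Bool) (i : Fin (ndisj (level n))),
        initState (Fin.append w c) (.inp i) = w (Fin.castLE (ndisj_level_le n) i) := by
      intro c i
      have hi : (i : ℕ) < n := i.2.trans_le (ndisj_level_le n)
      simp only [initState, show (i : ℕ) < n + n by omega, dite_true]
      exact Fin.append_left w c ⟨i, hi⟩
    have hc : ∀ (c : Fin n → Bool) (i : ℕ) (hi : i < n),
        initState (Fin.append w c) (.inp (n + i)) = c ⟨i, hi⟩ := by
      intro c i hi
      simp only [initState, show n + i < n + n by omega, dite_true]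
      exact Fin.append_right w c ⟨i, hi⟩
    have hlt : ∀ i, ∀ x ∈ (α (level n) i).1, x.1 < n := fun i x hx =>
      ((α (level n) i).2.1 x hx).trans_le (level_le n)
    have hGw : ∀ c : Fin n → Bool, G (n + n) (Fin.append w c) = true ↔
        ∀ i : Fin _, w (Fin.castLE (ndisj_level_le n) i) = true →
          ∃ x ∈ (α (level n) i).1, initState (Fin.append w c) (.inp (n + x.1)) = x.2 := by
      intro c
      rw [hG, hn]
      refine (hcs n fun i => initState (Fin.append w c) (.inp i)).trans ?_
      simp only [hw]
    simp only [threeSATC, decide_eq_true_iff, hGw]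
    constructor
    · rintro ⟨σ, hσ⟩
      refine ⟨fun i => σ i, fun i hi => ?_⟩
      obtain ⟨x, hx, hσx⟩ := hσ i hi
      exact ⟨x, hx, by rw [hc _ _ (hlt i x hx), hσx]⟩
    · rintro ⟨c, h⟩
      -- The default is harmless, as every variable occurring has index below `level n ≤ n`.
      refine ⟨fun i => if hi : i < n then c ⟨i, hi⟩ else false, fun i hi => ?_⟩
      obtain ⟨x, hx, hcx⟩ := h i hi
      refine ⟨x, hx, ?_⟩
      rw [hc _ _ (hlt i x hx)] at hcx
      simpa only [hlt i x hx, dite_true] using hcx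

/-! ### Hardness of 3SATC for NPLIS -/

theorem reducible_threeSATC (α : ∀ k, Fin (ndisj k) ≃ Clause k) {f : BoolFamily}
    (hf : f ∈ NDNUC ISbr poly) : Reducible ISbr poly f (threeSATC α) := by
  obtain ⟨h, hh, -, g, ⟨h', hh', hg⟩, hfg⟩ := hf
  have hlen : (fun n => h' (n + h n)) ∈ poly := comp_mem_poly hh' (add_mem_poly id_mem_poly hh)
  -- The summand 5 bounds the code length of each reduction bit; the other bounds the number `ndisj
  -- k` of bits, with the verifier's length bounded by `h' (n + h n)`.
  refine ⟨fun n => 5 + ndisj ((h' (n + h n) + 1) * (2 * h' (n + h n) + n + 2)),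
    add_mem_poly (const_mem_poly 5) (ndisj_mem_poly (mul_mem_poly
      (add_mem_poly hlen (const_mem_poly 1))
      (add_mem_poly (add_mem_poly (mul_mem_poly (const_mem_poly 2) hlen) id_mem_poly)
        (const_mem_poly 2)))), fun n => ?_⟩
  obtain ⟨X, -, hX, hXlen⟩ := hg (n + h n)
  obtain ⟨k, hk, hred⟩ := lengthReducible_threeSATC_of_computes α (hfg n) hX
  refine ⟨5, ndisj k, Nat.le_add_right _ _, ?_, hred⟩
  refine (ndisj_mono (hk.trans ?_)).trans (Nat.le_add_left _ _)
  exact Nat.mul_le_mul (by omega) (by omega)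

end InSeq

theorem mainTheorem3
    (α : ∀ k : ℕ, Fin (InSeq.ndisj k) ≃ InSeq.Clause k)
    (hα : ∀ (k : ℕ) (j : Fin (InSeq.ndisj k)),
      (α (k + 1) (Fin.castLE (InSeq.ndisj_mono (Nat.le_succ k)) j) : Finset InSeq.Literal) =
        (α k j : Finset InSeq.Literal)) :
    InSeq.NDComplete InSeq.ISbr InSeq.poly (InSeq.threeSATC α) :=
  ⟨InSeq.threeSATC_mem_NDNUC α, fun _ hg => InSeq.reducible_threeSATC α hg⟩
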